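/- Let $\mathbb T=\mathbb R/2\pi\mathbb Z$, and let $|x-y|$ denote the distance on $\mathbb T$ (modulo $2\pi$); diameters and distances of sets refer to it. Let $H:\mathbb R\to[0,1]$ be a low pass filter, i.e. $H$ is infinitely differentiable and even, $H(t)=1$ for $|t|\le 1/2$ and $H(t)=0$ for $|t|\ge 1$. For integers $n\ge1$ and $S\ge 2$ put $$\hbar_n=\Big\{\sum_{|\ell|<n}H(|\ell|/n)\Big\}^{-1},\qquad L=\frac{14\sqrt{2\pi}}{3}\cdot\frac{\|H^{(S)}\|_1}{\|H\|_1},$$ where $\|f\|_1=\int_{-1}^1|f(t)|\,dt$. Let $K\ge 1$, $\lambda_1,\dots,\lambda_K\in\mathbb T$, $A_1,\dots,A_K\in\mathbb C\setminus\{0\}$, and $$M=\sum_{k=1}^K|A_k|,\quad \mathfrak m=\min_{1\le k\le K}|A_k|,\quad \eta=\min_{k\ne \ell}|\lambda_k-\lambda_\ell|\ \ (\eta=\infty\text{ if }K=1),\quad C=\max\Big(1,\Big(\frac{16ML}{\mathfrak m}\Big)^{1/S}\Big).$$ Let the data be $\tilde\mu(\ell)=\sum_{k=1}^K A_k e^{-i\ell\lambda_k}+\epsilon_\ell$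 for $|\ell|<n$, where the $\epsilon_\ell$ are i.i.d. complex random variables whose real and imaginary parts are sub-Gaussian with parameter $V\ge0$: each of these real variables $X$ has mean zero and satisfies $\log\mathbb E(\exp(tX))\le (tV)^2/2$ for all $t\in\mathbb R$. Let $$\sigma_n(x)=\hbar_n\sum_{|\ell|<n}H\Big(\frac{|\ell|}{n}\Big)\tilde\mu(\ell)e^{i\ell x},\qquad \mathbb G=\{x\in\mathbb T:\ |\sigma_n(x)|\ge \mathfrak m/2\}.$$ There are constants $C_1\ge1$ and $C_2,C_3>0$, depending only on $H$, such that, whenever $0<\delta<1$ and $$n\ge \max(4C/\eta,\,C_1),\qquad C_2V\sqrt{\frac{\log(C_3n/\delta)}{n}}\le\frac{\mathfrak m}{16},$$ the following statements hold simultaneously with probability exceeding $1-\delta$: 1. (Disjoint union) $\mathbb G$ is a disjoint union of exactly $K$ (nonempty) subsets $\mathbb G_1,\dots,\mathbb G_K$, such that: 2. (Diameter) $\operatorname{diam}(\mathbb G_\ell)\le 2C/n$ for each $\ell$; 3. (Separation) $\operatorname{dist}(\mathbb G_\ell,\mathbb G_k)\ge\eta/2$ for $\ell\ne k$; 4. (Interval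 inclusion) $\{x\in\mathbb T:|x-\lambda_\ell|\le 1/(4n)\}\subseteq\mathbb G_\ell$ for each $\ell$; 5. (Estimation) for each $\ell$, $|\sigma_n|$ attains its maximum on $\mathbb G_\ell$, and every $\hat\lambda_\ell\in\arg\max_{x\in\mathbb G_\ell}|\sigma_n(x)|$ satisfies $|\hat\lambda_\ell-\lambda_\ell|\le 2C/n$. -/

import Mathlib

open MeasureTheory ProbabilityTheory
open scoped ENNReal NNReal

noncomputable section

/-- The circle `ℝ / 2πℤ`, with its quotient metric (the distance modulo `2π`). The character
`x ↦ exp (i ℓ x)` on it is Mathlib's `fourier ℓ`. -/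
abbrev Torus : Type := AddCircle (2 * Real.pi)

/-- A low pass filter: a smooth even function `ℝ → [0,1]`, equal to `1` for `|t| ≤ 1/2` and to `0`
for `|t| ≥ 1`. -/
structure IsLowPassFilter (H : ℝ → ℝ) : Prop where
  smooth : ContDiff ℝ ((⊤ : ℕ∞) : WithTop ℕ∞) H
  mem_Icc : ∀ t, H t ∈ Set.Icc (0 : ℝ) 1
  even : ∀ t, H (-t) = H t
  eq_one : ∀ t, |t| ≤ 1 / 2 → H t = 1
  eq_zero : ∀ t, 1 ≤ |t| → H t = 0

/-- The `L¹` norm on `[-1, 1]`. -/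
def l1Norm (f : ℝ → ℝ) : ℝ := ∫ t in (-1 : ℝ)..1, |f t|

/-- The constant `L = (14 √(2π) / 3) ‖H^(S)‖₁ / ‖H‖₁`. -/
def locConst (H : ℝ → ℝ) (S : ℕ) : ℝ :=
  14 * √(2 * Real.pi) / 3 * (l1Norm (iteratedDeriv S H) / l1Norm H)

/-- The normalizing factor `ħ_n = (∑_{|ℓ| < n} H(|ℓ|/n))⁻¹`. -/
def hbar (H : ℝ → ℝ) (n : ℕ) : ℝ :=
  (∑ ℓ ∈ Finset.Ioo (-(n : ℤ)) (n : ℤ), H (|(ℓ : ℝ)| / n))⁻¹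

/-- The reconstruction `σ_n(x) = ħ_n ∑_{|ℓ| < n} H(|ℓ|/n) d(ℓ) exp(i ℓ x)` from data `d`. -/
def powerSpectrum (H : ℝ → ℝ) (n : ℕ) (d : ℤ → ℂ) (x : Torus) : ℂ :=
  (hbar H n : ℂ) *
    ∑ ℓ ∈ Finset.Ioo (-(n : ℤ)) (n : ℤ), (H (|(ℓ : ℝ)| / n) : ℂ) * d ℓ * fourier ℓ x

/-- The Fourier coefficient `∑_k A_k exp(-i ℓ λ_k)` of the measure `∑_k A_k δ_{λ_k}`. -/
def fourierData {K : ℕ} (A : Fin K → ℂ) (lam : Fin K → Torus) (ℓ : ℤ) : ℂ :=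
  ∑ k, A k * fourier (-ℓ) (lam k)

/-- `M = ∑_k |A_k|`. -/
def totalAmplitude {K : ℕ} (A : Fin K → ℂ) : ℝ := ∑ k, ‖A k‖

/-- `𝔪 = min_k |A_k|` (used for `K ≥ 1`). -/
def minAmplitude {K : ℕ} (A : Fin K → ℂ) : ℝ := ⨅ k, ‖A k‖

/-- `η = min_{k ≠ l} |λ_k - λ_l|`, the distance being that of the circle. It is extended-real
valued so that it is `∞`, the minimum over no pairs, when there is a single point. -/
def minSeparation {K : ℕ} (lam : Fin K → Torus) : ℝ≥0∞ :=
  ⨅ (k : Fin K) (l : Fin K) (_ : k ≠ l), edist (lam k) (lam l)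

/-- `C = max (1, (16 M L / 𝔪)^(1/S))`. -/
def clusterConst (H : ℝ → ℝ) (S : ℕ) {K : ℕ} (A : Fin K → ℂ) : ℝ :=
  max 1 ((16 * totalAmplitude A * locConst H S / minAmplitude A) ^ (1 / (S : ℝ)))

/-- A complex random variable is sub-Gaussian with parameter `V` if its real and imaginary parts
are: `𝔼 exp(tX) ≤ exp((tV)²/2)` for all real `t` (in particular they have mean zero). -/
def IsComplexSubGaussian {Ω : Type*} [MeasurableSpace Ω] (X : Ω → ℂ) (V : ℝ≥0)
    (P : Measure Ω) : Prop :=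
  HasSubgaussianMGF (fun ω => (X ω).re) (V ^ 2) P ∧
    HasSubgaussianMGF (fun ω => (X ω).im) (V ^ 2) P

/-- The set `{x : |σ(x)| ≥ 𝔪/2}`. -/
def levelSet (σ : Torus → ℂ) (m : ℝ) : Set Torus := {x | m / 2 ≤ ‖σ x‖}

end

/-! ### Localization of the kernel by Poisson summation. -/

section Kernel

open scoped FourierTransform SchwartzMap ContDiff

/-! The reconstruction is `∑ A_k Φ_n(x - λ_k)` plus noise, where the kernel `Φ_n` equals 1 at 0.
Poisson summation and the smoothness of `H` give `|Φ_n(x)| ≤ L / (n|x|)^S`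
(`norm_lowPassKernel_le`), and `C` is chosen so that all sources at distance at least `C/n` together
contribute at most `𝔪/16` (`IsLowPassFilter.norm_sum_le`).

If the noise is also at most `𝔪/16` everywhere, then `|σ_n| ≤ 𝔪/8` off the balls of radius `C/n`
about the `λ_k`, while within `1/(4n)` of `λ_k` its own term is at least `31𝔪/32` and dominates. The
clusters are the intersections of the level set with these balls, well apart because `η ≥ 4C/n`
(`clusters_of_noise_le`).

The noise at one point is sub-Gaussian with variance proxy of order `V²/n`. A union bound over a
grid of `O(n²)` points, and the control of a trigonometric polynomial by its values there, make the
bound uniform (`exists_norm_powerSpectrum_le`). -/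

theorem pow_mul_norm_fourierInv_le {f : ℝ → ℂ} (hf : ContDiff ℝ ∞ f) (hc : HasCompactSupport f)
    (S : ℕ) (w : ℝ) :
    (2 * Real.pi * |w|) ^ S * ‖𝓕⁻ f w‖ ≤ ∫ t, ‖iteratedDeriv S f t‖ := by
  have hint : ∀ m : ℕ, (m : ℕ∞) ≤ (⊤ : ℕ∞) → Integrable (iteratedDeriv m f) := fun m _ =>
    (hf.continuous_iteratedDeriv m (by exact_mod_cast le_top)).integrable_of_hasCompactSupport
      ((hc.iteratedFDeriv (𝕜 := ℝ) m).comp_left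
        (g := fun q : ContinuousMultilinearMap ℝ (fun _ : Fin m => ℝ) ℂ => q fun _ => 1) rfl)
  -- Taking `S` derivatives multiplies the transform by `(2πiw)^S`; the sign of `w` turns the
  -- inverse transform into the direct one.
  have h := congrFun (Real.fourier_iteratedDeriv (n := S) hf hint le_top) (-w)
  rw [Real.fourierInv_eq_fourier_neg]
  have hn : (2 * Real.pi * |w|) ^ S * ‖𝓕 f (-w)‖ = ‖𝓕 (iteratedDeriv S f) (-w)‖ := by
    rw [h, norm_smul, norm_pow]
    simp [abs_of_pos Real.pi_pos]
  rw [hn]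
  exact VectorFourier.norm_fourierIntegral_le_integral_norm _ _ _ _ _

theorem norm_iteratedDeriv_ofReal_comp {g : ℝ → ℝ} (hg : ContDiff ℝ ∞ g) (S : ℕ) (t : ℝ) :
    ‖iteratedDeriv S (fun s => (g s : ℂ)) t‖ = |iteratedDeriv S g t| := by
  rw [← norm_iteratedFDeriv_eq_norm_iteratedDeriv, ← Real.norm_eq_abs,
    ← norm_iteratedFDeriv_eq_norm_iteratedDeriv]
  exact Complex.ofRealLI.norm_iteratedFDeriv_comp_left (hg.of_le le_rfl).contDiffAt
    (by exact_mod_cast le_top)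

namespace IsLowPassFilter

variable {H : ℝ → ℝ}

theorem tsupport_subset (hH : IsLowPassFilter H) : tsupport H ⊆ Set.Icc (-1) 1 := by
  refine closure_minimal (fun t ht => ?_) isClosed_Icc
  by_contra h
  exact ht (hH.eq_zero t (not_lt.1 fun h' => h (abs_le.1 h'.le)))

theorem integral_abs_iteratedDeriv (hH : IsLowPassFilter H) (S : ℕ) :
    ∫ t, |iteratedDeriv S H t| = l1Norm (iteratedDeriv S H) := by
  rw [l1Norm, intervalIntegral.integral_of_le (by norm_num), ← integral_Icc_eq_integral_Ioc,
    setIntegral_eq_integral_of_forall_compl_eq_zero]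
  intro t ht
  rw [abs_eq_zero]
  by_contra h
  refine ht (hH.tsupport_subset ?_)
  have := support_iteratedFDeriv_subset (𝕜 := ℝ) (f := H) S
  apply this
  rw [Function.mem_support, ← norm_ne_zero_iff, norm_iteratedFDeriv_eq_norm_iteratedDeriv]
  simpa using h

/-- `∫ |(H(·/n))^(S)| = n^(1-S) ‖H^(S)‖₁`. -/
theorem integral_norm_iteratedDeriv_comp_div (hH : IsLowPassFilter H) (S : ℕ) {n : ℕ}
    (hn : 1 ≤ n) :
    ∫ t, ‖iteratedDeriv S (fun s => (H (s / n) : ℂ)) t‖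
      = n / (n : ℝ) ^ S * l1Norm (iteratedDeriv S H) := by
  have hg : ContDiff ℝ ∞ (fun s : ℝ => H (s / n)) := hH.smooth.comp (contDiff_id.div_const _)
  have hn0 : (0 : ℝ) < n := by exact_mod_cast hn
  have h1 : ∀ t : ℝ, ‖iteratedDeriv S (fun s => (H (s / n) : ℂ)) t‖
      = ((n : ℝ) ^ S)⁻¹ * |iteratedDeriv S H (t / n)| := by
    intro t
    rw [norm_iteratedDeriv_ofReal_comp hg]
    have : (fun s : ℝ => H (s / n)) = fun s => H ((n : ℝ)⁻¹ * s) := by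
      funext s; congr 1; ring
    rw [this, iteratedDeriv_comp_const_mul (hH.smooth.of_le (by exact_mod_cast le_top))]
    simp only [abs_mul, inv_pow]
    rw [abs_of_pos (by positivity)]
    congr 3; ring
  simp_rw [h1]
  rw [integral_const_mul, Measure.integral_comp_div (fun t => |iteratedDeriv S H t|) (n : ℝ),
    hH.integral_abs_iteratedDeriv, abs_of_pos hn0, smul_eq_mul]
  ring

theorem hasCompactSupport_comp_div (hH : IsLowPassFilter H) {n : ℕ} (hn : 1 ≤ n) :
    HasCompactSupport (fun s : ℝ => (H (s / n) : ℂ)) := by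
  have hn0 : (0 : ℝ) < n := by exact_mod_cast hn
  refine HasCompactSupport.intro (isCompact_Icc (a := -(n : ℝ)) (b := n)) fun s hs => ?_
  rw [hH.eq_zero, Complex.ofReal_zero]
  rw [abs_div, abs_of_pos hn0, one_le_div hn0]
  by_contra h
  exact hs (abs_le.1 (not_le.1 h).le)

/-- Poisson summation for the inverse transform of `H(·/n)`: its transform is `H(·/n)` again, which
vanishes at all integers `|ℓ| ≥ n`. -/
theorem sum_fourier_eq_tsum (hH : IsLowPassFilter H) {n : ℕ} (hn : 1 ≤ n) (y : ℝ) :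
    ∑ ℓ ∈ Finset.Ioo (-(n : ℤ)) (n : ℤ), (H (|(ℓ : ℝ)| / n) : ℂ) * fourier ℓ (y : UnitAddCircle)
      = ∑' j : ℤ, 𝓕⁻ (fun s : ℝ => (H (s / n) : ℂ)) (y + j) := by
  have hn0 : (0 : ℝ) < n := by exact_mod_cast hn
  have hg : ContDiff ℝ ∞ (fun s : ℝ => (H (s / n) : ℂ)) :=
    Complex.ofRealCLM.contDiff.comp (hH.smooth.comp (contDiff_id.div_const _))
  have hc := hH.hasCompactSupport_comp_div hn
  have h := SchwartzMap.tsum_eq_tsum_fourier (𝓕⁻ (hc.toSchwartzMap hg)) y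
  rw [FourierTransform.fourier_fourierInv_eq] at h
  rw [SchwartzMap.fourierInv_coe] at h
  have e : (⇑(hc.toSchwartzMap hg) : ℝ → ℂ) = fun s : ℝ => (H (s / n) : ℂ) := rfl
  rw [e] at h
  rw [h, tsum_eq_sum (s := Finset.Ioo (-(n : ℤ)) (n : ℤ))]
  · refine Finset.sum_congr rfl fun ℓ _ => ?_
    congr 2
    rcases abs_choice (ℓ : ℝ) with h | h <;> rw [h]
    rw [neg_div, hH.even]
  · intro ℓ hℓ
    have : (n : ℤ) ≤ |ℓ| := by
      by_contra hh
      exact hℓ (Finset.mem_Ioo.2 (abs_lt.1 (not_le.1 hh)))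
    have h2 : (n : ℝ) ≤ |(ℓ : ℝ)| := by exact_mod_cast this
    beta_reduce
    rw [hH.eq_zero, Complex.ofReal_zero, zero_mul]
    rwa [abs_div, abs_of_pos hn0, one_le_div hn0]

end IsLowPassFilter

/-- The sum is `1 + 2ζ(2)`, since `1 / 0 = 0` makes the second summand vanish at `j = 0`. -/
theorem hasSum_int_indicator_add_one_div_sq :
    HasSum (fun j : ℤ => (if j = 0 then 1 else 0) + 1 / (j : ℝ) ^ 2)
      (1 + Real.pi ^ 2 / 3) := by
  refine (hasSum_ite_eq (0 : ℤ) (1 : ℝ)).add ?_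
  have h := HasSum.of_nat_of_neg (f := fun j : ℤ => 1 / (j : ℝ) ^ 2)
    (by simpa using hasSum_zeta_two) (by simpa using hasSum_zeta_two)
  have e : Real.pi ^ 2 / 6 + Real.pi ^ 2 / 6 - 1 / ((0 : ℤ) : ℝ) ^ 2 = Real.pi ^ 2 / 3 := by
    rw [Int.cast_zero]; ring
  rw [e] at h
  exact h

/-- For `j ≠ 0`, `|y| ≤ 1/2` gives `|y + j| ≥ |j| - |y| ≥ |j||y|`. The periodized decay is thus a
summable multiple of its central term. -/
theorem one_div_abs_add_int_pow_le {y : ℝ} (hy : y ≠ 0) (hy2 : |y| ≤ 1 / 2) {S : ℕ} (hS : 2 ≤ S)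
    (j : ℤ) :
    1 / |y + j| ^ S ≤ 1 / |y| ^ S * ((if j = 0 then 1 else 0) + 1 / (j : ℝ) ^ 2) := by
  by_cases hj : j = 0
  · simp [hj]
  have hy0 : 0 < |y| := abs_pos.2 hy
  have hj1 : (1 : ℝ) ≤ |(j : ℝ)| := by exact_mod_cast Int.one_le_abs hj
  have h1 : |(j : ℝ)| * |y| ≤ |y + j| := by
    have : |(j : ℝ)| - |y| ≤ |y + j| := by
      have := abs_sub_abs_le_abs_sub (j : ℝ) (-y)
      rw [abs_neg, sub_neg_eq_add, add_comm (j : ℝ)] at this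
      exact this
    nlinarith
  have h2 : (j : ℝ) ^ 2 * |y| ^ S ≤ |y + j| ^ S := by
    refine le_trans ?_ (pow_le_pow_left₀ (by positivity) h1 S)
    rw [mul_pow, ← sq_abs]
    gcongr
  rw [if_neg hj, zero_add, one_div_mul_one_div, mul_comm (|y| ^ S)]
  have hj2 : (0 : ℝ) < (j : ℝ) ^ 2 := by positivity
  exact one_div_le_one_div_of_le (by positivity) h2

/-- The kernel `Φ_n(x) = ħ_n ∑_{|ℓ| < n} H(|ℓ|/n) exp(i ℓ x)`. -/
noncomputable def lowPassKernel (H : ℝ → ℝ) (n : ℕ) (x : Torus) : ℂ :=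
  (hbar H n : ℂ) * ∑ ℓ ∈ Finset.Ioo (-(n : ℤ)) (n : ℤ), (H (|(ℓ : ℝ)| / n) : ℂ) * fourier ℓ x

theorem exists_coe_eq_abs_eq_norm (x : Torus) :
    ∃ r : ℝ, (r : Torus) = x ∧ |r| = ‖x‖ ∧ |r| ≤ Real.pi := by
  obtain ⟨r, rfl⟩ := QuotientAddGroup.mk_surjective x
  have hpi := Real.pi_pos
  have hle := AddCircle.norm_le_half_period (2 * Real.pi) (x := (r : Torus)) (by positivity)
  have he := AddCircle.norm_eq (2 * Real.pi) (x := r)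
  refine ⟨r - round ((2 * Real.pi)⁻¹ * r) * (2 * Real.pi), ?_, he.symm, ?_⟩
  · rw [← zsmul_eq_mul, AddCircle.coe_sub, AddCircle.coe_zsmul, AddCircle.coe_period, smul_zero,
      sub_zero]
  · rw [← he]
    refine hle.trans (le_of_eq ?_)
    rw [abs_of_pos (by positivity)]; ring

theorem fourier_coe_torus (ℓ : ℤ) (r : ℝ) :
    fourier ℓ (r : Torus) = Complex.exp ((ℓ * r : ℝ) * Complex.I) := by
  rw [fourier_coe_apply]
  congr 1
  have : (Real.pi : ℂ) ≠ 0 := by exact_mod_cast Real.pi_ne_zero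
  push_cast
  field_simp

theorem fourier_coe_torus_eq_unit (ℓ : ℤ) (r : ℝ) :
    fourier ℓ (r : Torus) = fourier ℓ ((r / (2 * Real.pi) : ℝ) : UnitAddCircle) := by
  rw [fourier_coe_apply, fourier_coe_apply]
  congr 1
  push_cast
  ring

namespace IsLowPassFilter

variable {H : ℝ → ℝ}

theorem norm_sum_fourier_le (hH : IsLowPassFilter H) {n : ℕ} (hn : 1 ≤ n) {S : ℕ} (hS : 2 ≤ S)
    {y : ℝ} (hy : y ≠ 0) (hy2 : |y| ≤ 1 / 2) :
    ‖∑ ℓ ∈ Finset.Ioo (-(n : ℤ)) (n : ℤ),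
        (H (|(ℓ : ℝ)| / n) : ℂ) * fourier ℓ (y : UnitAddCircle)‖
      ≤ n * l1Norm (iteratedDeriv S H) / (n * (2 * Real.pi * |y|)) ^ S *
        (1 + Real.pi ^ 2 / 3) := by
  have hn0 : (0 : ℝ) < n := by exact_mod_cast hn
  have hpi := Real.pi_pos
  have hg : ContDiff ℝ ∞ (fun s : ℝ => (H (s / n) : ℂ)) :=
    Complex.ofRealCLM.contDiff.comp (hH.smooth.comp (contDiff_id.div_const _))
  have hl : 0 ≤ l1Norm (iteratedDeriv S H) := by
    rw [← hH.integral_abs_iteratedDeriv]; positivity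
  rw [hH.sum_fourier_eq_tsum hn]
  refine tsum_of_norm_bounded (hasSum_int_indicator_add_one_div_sq.mul_left _) fun j => ?_
  have h1 := pow_mul_norm_fourierInv_le hg (hH.hasCompactSupport_comp_div hn) S (y + j)
  rw [hH.integral_norm_iteratedDeriv_comp_div S hn] at h1
  have hyj : 0 < |y + j| := by
    rw [abs_pos]
    intro h0
    by_cases hj : j = 0
    · simp [hj] at h0; exact hy h0
    · have hj1 : (1 : ℝ) ≤ |(j : ℝ)| := by exact_mod_cast Int.one_le_abs hj
      rw [← neg_eq_of_add_eq_zero_right h0, abs_neg] at hj1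
      linarith
  have h2 := one_div_abs_add_int_pow_le hy hy2 hS j
  calc ‖𝓕⁻ (fun s : ℝ => (H (s / n) : ℂ)) (y + j)‖
      ≤ n / (n : ℝ) ^ S * l1Norm (iteratedDeriv S H) / (2 * Real.pi * |y + j|) ^ S := by
        rw [le_div_iff₀ (by positivity), mul_comm]; exact h1
    _ = n / (n : ℝ) ^ S * l1Norm (iteratedDeriv S H) / (2 * Real.pi) ^ S * (1 / |y + j| ^ S) := by
        rw [mul_pow]; field_simp
    _ ≤ n / (n : ℝ) ^ S * l1Norm (iteratedDeriv S H) / (2 * Real.pi) ^ S * _ :=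
        mul_le_mul_of_nonneg_left h2 (by positivity)
    _ = _ := by
        have : 0 < |y| := abs_pos.2 hy
        simp only [mul_pow]; field_simp

/-- `H = 1` at the `2⌊n/2⌋ + 1 ≥ n` frequencies with `|ℓ| ≤ n/2`. Hence `ħ_n ≤ 1/n`. -/
theorem nat_le_sum (hH : IsLowPassFilter H) {n : ℕ} (hn : 1 ≤ n) :
    (n : ℝ) ≤ ∑ ℓ ∈ Finset.Ioo (-(n : ℤ)) (n : ℤ), H (|(ℓ : ℝ)| / n) := by
  have hn0 : (0 : ℝ) < n := by exact_mod_cast hn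
  have hsub : Finset.Icc (-((n / 2 : ℕ) : ℤ)) ((n / 2 : ℕ) : ℤ)
      ⊆ Finset.Ioo (-(n : ℤ)) (n : ℤ) := by
    intro ℓ; simp only [Finset.mem_Icc, Finset.mem_Ioo]; omega
  refine le_trans ?_ (Finset.sum_le_sum_of_subset_of_nonneg hsub fun ℓ _ _ => (hH.mem_Icc _).1)
  have : ∑ ℓ ∈ Finset.Icc (-((n / 2 : ℕ) : ℤ)) ((n / 2 : ℕ) : ℤ), H (|(ℓ : ℝ)| / n)
      = ∑ ℓ ∈ Finset.Icc (-((n / 2 : ℕ) : ℤ)) ((n / 2 : ℕ) : ℤ), (1 : ℝ) := by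
    refine Finset.sum_congr rfl fun ℓ hℓ => hH.eq_one _ ?_
    have h1 : 2 * |ℓ| ≤ n := by
      have := abs_le.2 (Finset.mem_Icc.1 hℓ); omega
    have h2 : 2 * |(ℓ : ℝ)| ≤ n := by exact_mod_cast h1
    rw [abs_of_nonneg (by positivity), div_le_iff₀ hn0]
    linarith
  rw [this, Finset.sum_const, Int.card_Icc, nsmul_eq_mul, mul_one]
  have : n ≤ (((n / 2 : ℕ) : ℤ) + 1 - -((n / 2 : ℕ) : ℤ)).toNat := by omega
  exact_mod_cast this

theorem hbar_pos (hH : IsLowPassFilter H) {n : ℕ} (hn : 1 ≤ n) : 0 < hbar H n :=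
  inv_pos.2 (lt_of_lt_of_le (by exact_mod_cast hn) (hH.nat_le_sum hn))

theorem hbar_mul_le_one (hH : IsLowPassFilter H) {n : ℕ} (hn : 1 ≤ n) : hbar H n * n ≤ 1 := by
  have h := hH.nat_le_sum hn
  have hn0 : (0 : ℝ) < n := by exact_mod_cast hn
  rw [hbar, inv_mul_le_iff₀ (hn0.trans_le h), mul_one]
  exact h

theorem hbar_mul_sum (hH : IsLowPassFilter H) {n : ℕ} (hn : 1 ≤ n) :
    hbar H n * ∑ ℓ ∈ Finset.Ioo (-(n : ℤ)) (n : ℤ), H (|(ℓ : ℝ)| / n) = 1 :=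
  inv_mul_cancel₀ (lt_of_lt_of_le (by exact_mod_cast hn) (hH.nat_le_sum hn)).ne'

theorem l1Norm_pos (hH : IsLowPassFilter H) : 0 < l1Norm H := by
  refine intervalIntegral.integral_pos (by norm_num) hH.smooth.continuous.abs.continuousOn
    (fun _ _ => abs_nonneg _) ⟨0, by norm_num, ?_⟩
  rw [hH.eq_one 0 (by norm_num)]; norm_num

theorem l1Norm_le_two (hH : IsLowPassFilter H) : l1Norm H ≤ 2 := by
  have h : l1Norm H ≤ ∫ _ in (-1 : ℝ)..1, (1 : ℝ) :=
    intervalIntegral.integral_mono_on (by norm_num)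
      (hH.smooth.continuous.abs.intervalIntegrable _ _) (by simp) fun t _ => by
        rw [abs_of_nonneg (hH.mem_Icc t).1]; exact (hH.mem_Icc t).2
  refine h.trans (le_of_eq ?_)
  simp; norm_num

theorem locConst_nonneg (hH : IsLowPassFilter H) (S : ℕ) : 0 ≤ locConst H S := by
  have : 0 ≤ l1Norm (iteratedDeriv S H) := by
    rw [← hH.integral_abs_iteratedDeriv]; positivity
  have := hH.l1Norm_pos
  unfold locConst
  positivity

/-- Localization of the kernel: `|Φ_n(x)| ≤ L / (n |x|)^S`. -/
theorem norm_lowPassKernel_le (hH : IsLowPassFilter H) {n : ℕ} (hn : 1 ≤ n) {S : ℕ} (hS : 2 ≤ S)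
    {x : Torus} (hx : x ≠ 0) : ‖lowPassKernel H n x‖ ≤ locConst H S / (n * ‖x‖) ^ S := by
  obtain ⟨r, rfl, hr, hrpi⟩ := exists_coe_eq_abs_eq_norm x
  have hpi := Real.pi_pos
  have hn0 : (0 : ℝ) < n := by exact_mod_cast hn
  have hr0 : r ≠ 0 := by rintro rfl; exact hx rfl
  have hy : |r / (2 * Real.pi)| = |r| / (2 * Real.pi) := by
    rw [abs_div, abs_of_pos (a := 2 * Real.pi) (by positivity)]
  have h := hH.norm_sum_fourier_le hn hS (y := r / (2 * Real.pi)) (by positivity)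
    (by rw [hy, div_le_iff₀ (by positivity)]; linarith)
  rw [hy, mul_div_cancel₀ _ (by positivity : 2 * Real.pi ≠ 0)] at h
  simp_rw [← fourier_coe_torus_eq_unit] at h
  have hD : 0 ≤ l1Norm (iteratedDeriv S H) := by
    rw [← hH.integral_abs_iteratedDeriv]; positivity
  have hl := hH.l1Norm_pos
  have hl2 := hH.l1Norm_le_two
  rw [lowPassKernel, norm_mul, Complex.norm_real, Real.norm_of_nonneg (hH.hbar_pos hn).le, ← hr]
  set D := l1Norm (iteratedDeriv S H)
  set R := ((n : ℝ) * |r|) ^ S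
  have hR : 0 < R := by have := abs_pos.2 hr0; positivity
  -- Numerical room: `‖H‖₁ ≤ 2` and `1 + π²/3 ≤ 13/3` lead to the factor `26/3`, below `14 · (5/2) /
  -- 3`.
  have hsq : (5 / 2 : ℝ) ≤ √(2 * Real.pi) := by
    apply Real.le_sqrt_of_sq_le
    linarith [Real.pi_gt_d2]
  have hpi2 : Real.pi ^ 2 ≤ 10 := by nlinarith [Real.pi_lt_d2]
  have hDl : D ≤ 2 * (D / l1Norm H) := by
    rw [mul_div_assoc', le_div_iff₀ hl]; nlinarith
  calc hbar H n * _ ≤ hbar H n * (n * D / R * (1 + Real.pi ^ 2 / 3)) :=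
        mul_le_mul_of_nonneg_left h (hH.hbar_pos hn).le
    _ = (hbar H n * n) * (D / R * (1 + Real.pi ^ 2 / 3)) := by ring
    _ ≤ 1 * (D / R * (1 + Real.pi ^ 2 / 3)) :=
        mul_le_mul_of_nonneg_right (hH.hbar_mul_le_one hn) (by positivity)
    _ = D * (1 + Real.pi ^ 2 / 3) / R := by ring
    _ ≤ locConst H S / R := by
        gcongr
        unfold locConst
        have hq : 0 ≤ D / l1Norm H := by positivity
        calc D * (1 + Real.pi ^ 2 / 3) ≤ (2 * (D / l1Norm H)) * (13 / 3) := by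
              gcongr; linarith
          _ = 26 / 3 * (D / l1Norm H) := by ring
          _ ≤ 14 * √(2 * Real.pi) / 3 * (D / l1Norm H) := by
              gcongr; linarith

/-- The real part is an average of `cos(ℓx)` with weights `ħ_n H(|ℓ|/n)`; here `|ℓx| ≤ 1/4`, so each
cosine is at least `1 - 1/32`. -/
theorem norm_lowPassKernel_ge (hH : IsLowPassFilter H) {n : ℕ} (hn : 1 ≤ n) {x : Torus}
    (hx : ‖x‖ ≤ 1 / (4 * n)) : 31 / 32 ≤ ‖lowPassKernel H n x‖ := by
  obtain ⟨r, rfl, hr, -⟩ := exists_coe_eq_abs_eq_norm x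
  have hn0 : (0 : ℝ) < n := by exact_mod_cast hn
  rw [← hr] at hx
  refine le_trans ?_ (Complex.re_le_norm _)
  have hre : (lowPassKernel H n (r : Torus)).re = hbar H n *
      ∑ ℓ ∈ Finset.Ioo (-(n : ℤ)) (n : ℤ), H (|(ℓ : ℝ)| / n) * Real.cos (ℓ * r) := by
    rw [lowPassKernel, Complex.re_ofReal_mul, Complex.re_sum]
    congr 1
    refine Finset.sum_congr rfl fun ℓ _ => ?_
    rw [Complex.re_ofReal_mul, fourier_coe_torus, Complex.exp_ofReal_mul_I_re]
  rw [hre, ← mul_one (31 / 32 : ℝ), ← hH.hbar_mul_sum hn, mul_left_comm, Finset.mul_sum]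
  refine mul_le_mul_of_nonneg_left (Finset.sum_le_sum fun ℓ hℓ => ?_) (hH.hbar_pos hn).le
  rw [mul_comm]
  refine mul_le_mul_of_nonneg_left ?_ (hH.mem_Icc _).1
  have h1 : |(ℓ : ℝ)| ≤ n := by
    have := abs_lt.2 (Finset.mem_Ioo.1 hℓ)
    exact_mod_cast this.le
  have h2 : |(ℓ : ℝ) * r| ≤ 1 / 4 := by
    rw [abs_mul]
    calc |(ℓ : ℝ)| * |r| ≤ n * (1 / (4 * n)) := by gcongr
      _ = 1 / 4 := by field_simp
  have h3 := Real.one_sub_sq_div_two_le_cos (x := ℓ * r)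
  have h4 : ((ℓ : ℝ) * r) ^ 2 ≤ (1 / 4) ^ 2 := sq_le_sq' (abs_le.1 h2).1 (abs_le.1 h2).2
  linarith

end IsLowPassFilter

end Kernel

/-! ### The noiseless reconstruction as a sum of shifted kernels. -/

instance fact_two_mul_pi_pos : Fact (0 < 2 * Real.pi) := ⟨Real.two_pi_pos⟩

theorem powerSpectrum_add (H : ℝ → ℝ) (n : ℕ) (d d' : ℤ → ℂ) (x : Torus) :
    powerSpectrum H n (fun ℓ => d ℓ + d' ℓ) x
      = powerSpectrum H n d x + powerSpectrum H n d' x := by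
  simp only [powerSpectrum, mul_add, add_mul, Finset.sum_add_distrib]

theorem fourier_mul_fourier_neg (ℓ : ℤ) (x y : Torus) :
    fourier (-ℓ) y * fourier ℓ x = fourier ℓ (x - y) := by
  rw [fourier_apply, fourier_apply, fourier_apply, ← Circle.coe_mul, ← AddCircle.toCircle_add,
    neg_smul, smul_sub, neg_add_eq_sub]

theorem powerSpectrum_fourierData (H : ℝ → ℝ) (n : ℕ) {K : ℕ} (A : Fin K → ℂ)
    (lam : Fin K → Torus) (x : Torus) :
    powerSpectrum H n (fourierData A lam) x = ∑ k, A k * lowPassKernel H n (x - lam k) := by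
  simp only [powerSpectrum, fourierData, lowPassKernel, Finset.mul_sum, Finset.sum_mul]
  rw [Finset.sum_comm]
  refine Finset.sum_congr rfl fun k _ => Finset.sum_congr rfl fun ℓ _ => ?_
  rw [← fourier_mul_fourier_neg]
  ring

theorem continuous_powerSpectrum (H : ℝ → ℝ) (n : ℕ) (d : ℤ → ℂ) :
    Continuous (powerSpectrum H n d) := by
  unfold powerSpectrum
  fun_prop

section Amplitudes

variable {K : ℕ} {A : Fin K → ℂ}

theorem minAmplitude_le (A : Fin K → ℂ) (k : Fin K) : minAmplitude A ≤ ‖A k‖ :=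
  ciInf_le (Set.finite_range _).bddBelow k

theorem minAmplitude_pos (hK : 1 ≤ K) (hA : ∀ k, A k ≠ 0) : 0 < minAmplitude A := by
  have : Nonempty (Fin K) := ⟨⟨0, hK⟩⟩
  obtain ⟨k, hk⟩ := exists_eq_ciInf_of_finite (f := fun k => ‖A k‖)
  rw [minAmplitude, ← hk]
  exact norm_pos_iff.2 (hA k)

theorem one_le_clusterConst (H : ℝ → ℝ) (S : ℕ) (A : Fin K → ℂ) : 1 ≤ clusterConst H S A :=
  le_max_left _ _

/-- Points at distance at least `C / n` from `lam k`, `k ∈ s`, get only a small contribution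
from them. -/
theorem IsLowPassFilter.norm_sum_le {H : ℝ → ℝ} (hH : IsLowPassFilter H) {S : ℕ} (hS : 2 ≤ S)
    (hK : 1 ≤ K) (hA : ∀ k, A k ≠ 0) (lam : Fin K → Torus) {n : ℕ} (hn : 1 ≤ n)
    (s : Finset (Fin K)) {x : Torus} (hx : ∀ k ∈ s, clusterConst H S A / n ≤ dist x (lam k)) :
    ‖∑ k ∈ s, A k * lowPassKernel H n (x - lam k)‖ ≤ minAmplitude A / 16 := by
  have hn0 : (0 : ℝ) < n := by exact_mod_cast hn
  have hm := minAmplitude_pos hK hA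
  have hL := hH.locConst_nonneg S
  have hM : 0 ≤ totalAmplitude A := Finset.sum_nonneg fun _ _ => norm_nonneg _
  have hC1 := one_le_clusterConst H S A
  -- The defining property of `C`: it says `M L / C^S ≤ 𝔪/16`.
  have hCS : 16 * totalAmplitude A * locConst H S / minAmplitude A ≤ clusterConst H S A ^ S := by
    refine le_trans (le_of_eq ?_) (pow_le_pow_left₀ (by positivity) (le_max_right _ _) S)
    rw [one_div, Real.rpow_inv_natCast_pow (by positivity) (by omega)]
  set C := clusterConst H S A
  have hker : ∀ k ∈ s, ‖lowPassKernel H n (x - lam k)‖ ≤ locConst H S / C ^ S := by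
    intro k hk
    have hd : C ≤ n * ‖x - lam k‖ := by
      have := hx k hk
      rw [div_le_iff₀ hn0, dist_eq_norm] at this
      linarith
    have hne : x - lam k ≠ 0 := by
      intro h0
      rw [h0, norm_zero, mul_zero] at hd
      linarith
    refine (hH.norm_lowPassKernel_le hn hS hne).trans ?_
    gcongr
  calc ‖∑ k ∈ s, A k * lowPassKernel H n (x - lam k)‖
      ≤ ∑ k ∈ s, ‖A k‖ * (locConst H S / C ^ S) := by
        refine (_root_.norm_sum_le _ _).trans (Finset.sum_le_sum fun k hk => ?_)
        rw [norm_mul]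
        exact mul_le_mul_of_nonneg_left (hker k hk) (norm_nonneg _)
    _ ≤ ∑ k, ‖A k‖ * (locConst H S / C ^ S) :=
        Finset.sum_le_sum_of_subset_of_nonneg (Finset.subset_univ _) fun _ _ _ => by positivity
    _ = totalAmplitude A * locConst H S / C ^ S := by
        rw [← Finset.sum_mul, totalAmplitude, mul_div_assoc]
    _ ≤ minAmplitude A / 16 := by
        rw [div_le_iff₀ hm] at hCS
        rw [div_le_iff₀ (by positivity)]
        linarith

end Amplitudes

/-! ### Clusters of the level set under small noise. -/

theorem minSeparation_le {K : ℕ} (lam : Fin K → Torus) {k l : Fin K} (h : k ≠ l) :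
    minSeparation lam ≤ edist (lam k) (lam l) :=
  iInf_le_of_le k (iInf_le_of_le l (iInf_le _ h))

/-- The deterministic half: the noise enters only through its uniform bound. The cluster `G k` is
the level set cut by the closed ball of radius `C/n` about `lam k`. -/
theorem clusters_of_noise_le {H : ℝ → ℝ} (hH : IsLowPassFilter H) {S : ℕ} (hS : 2 ≤ S) {K : ℕ}
    (hK : 1 ≤ K) {A : Fin K → ℂ} (lam : Fin K → Torus) (hA : ∀ k, A k ≠ 0) {n : ℕ} (hn : 1 ≤ n)
    (hsep : ENNReal.ofReal (4 * clusterConst H S A) / minSeparation lam ≤ n)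
    {d : ℤ → ℂ} (hd : ∀ x, ‖powerSpectrum H n d x‖ ≤ minAmplitude A / 16)
    {σ : Torus → ℂ} (hσ : σ = powerSpectrum H n (fun ℓ => fourierData A lam ℓ + d ℓ)) :
    ∃ G : Fin K → Set Torus,
      levelSet σ (minAmplitude A) = ⋃ k, G k ∧
      Pairwise (fun k l => Disjoint (G k) (G l)) ∧
      (∀ k, Metric.diam (G k) ≤ 2 * clusterConst H S A / n) ∧
      (∀ k l, k ≠ l → ∀ x ∈ G k, ∀ y ∈ G l, minSeparation lam / 2 ≤ edist x y) ∧
      (∀ k, Metric.closedBall (lam k) (1 / (4 * n)) ⊆ G k) ∧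
      (∀ k, ∃ x ∈ G k, IsMaxOn (fun y => ‖σ y‖) (G k) x) ∧
      (∀ k, ∀ x ∈ G k, IsMaxOn (fun y => ‖σ y‖) (G k) x →
        dist x (lam k) ≤ 2 * clusterConst H S A / n) := by
  have hn0 : (0 : ℝ) < n := by exact_mod_cast hn
  have hm := minAmplitude_pos hK hA
  have hC1 := one_le_clusterConst H S A
  have hsum : ∀ s x, (∀ k ∈ s, _) → _ := fun s x => hH.norm_sum_le hS hK hA lam hn s (x := x)
  set C := clusterConst H S A
  set m := minAmplitude A
  have hσx : ∀ x, σ x = ∑ k, A k * lowPassKernel H n (x - lam k) + powerSpectrum H n d x := by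
    intro x
    rw [hσ, powerSpectrum_add]
    exact congrArg (· + _) (powerSpectrum_fourierData H n A lam x)
  have hcont : Continuous fun x => ‖σ x‖ := by
    rw [hσ]; exact (continuous_powerSpectrum _ _ _).norm
  -- In `ℝ≥0∞`, separation `0` makes the quotient `∞`, which `hsep` excludes; separation `∞` (a
  -- single source) makes it `0`.
  have hsep1 : ENNReal.ofReal (4 * C / n) ≤ minSeparation lam := by
    have hne : minSeparation lam ≠ 0 := by
      intro h0
      rw [h0, ENNReal.div_zero (ENNReal.ofReal_pos.2 (by linarith)).ne'] at hsep
      exact ENNReal.natCast_ne_top n (top_le_iff.1 hsep)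
    rw [ENNReal.ofReal_div_of_pos hn0, ENNReal.ofReal_natCast]
    refine ENNReal.div_le_of_le_mul ?_
    by_cases ht : minSeparation lam = ⊤
    · rw [ht, ENNReal.top_mul (by exact_mod_cast (by omega : n ≠ 0))]; exact le_top
    · exact ((ENNReal.div_le_iff hne ht).1 hsep).trans_eq (mul_comm _ _)
  have hsepd : ∀ k l, k ≠ l → 4 * C / n ≤ dist (lam k) (lam l) := by
    intro k l hkl
    have h := hsep1.trans (minSeparation_le lam hkl)
    rw [edist_dist] at h
    exact (ENNReal.ofReal_le_ofReal_iff dist_nonneg).1 h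
  have hCn : 1 / (4 * n) ≤ C / n := by
    rw [div_le_div_iff₀ (by positivity) hn0]; nlinarith
  have hCn0 : 0 < C / n := by positivity
  have h4C : 4 * C / n = 4 * (C / n) := by ring
  have h2C : 2 * C / n = 2 * (C / n) := by ring
  have hball : ∀ k, Metric.closedBall (lam k) (1 / (4 * n))
      ⊆ levelSet σ m ∩ Metric.closedBall (lam k) (C / n) := by
    intro k x hx
    refine ⟨?_, Metric.closedBall_subset_closedBall hCn hx⟩
    have hx' := Metric.mem_closedBall.1 hx
    have h1 := hH.norm_lowPassKernel_ge hn (x := x - lam k) (by rwa [← dist_eq_norm])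
    have h2 : ‖∑ l ∈ Finset.univ.erase k, A l * lowPassKernel H n (x - lam l)‖ ≤ m / 16 := by
      refine hsum _ _ fun l hl => ?_
      have h3 := hsepd k l (Finset.ne_of_mem_erase hl).symm
      have h4 := dist_triangle_left (lam k) (lam l) x
      linarith
    have h3 := hd x
    have h4 : A k * lowPassKernel H n (x - lam k)
        = σ x - (∑ l ∈ Finset.univ.erase k, A l * lowPassKernel H n (x - lam l)
          + powerSpectrum H n d x) := by
      rw [hσx, ← Finset.add_sum_erase _ _ (Finset.mem_univ k)]; ring
    have h5 : ‖A k * lowPassKernel H n (x - lam k)‖ ≤ ‖σ x‖ + (m / 16 + m / 16) := by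
      rw [h4]
      exact (norm_sub_le _ _).trans (by gcongr; exact (norm_add_le _ _).trans (by gcongr))
    have h6 : m * (31 / 32) ≤ ‖A k * lowPassKernel H n (x - lam k)‖ := by
      rw [norm_mul]
      exact mul_le_mul (minAmplitude_le A k) h1 (by norm_num) (norm_nonneg _)
    change m / 2 ≤ ‖σ x‖
    linarith
  have hsepG : ∀ k l, k ≠ l → ∀ x ∈ levelSet σ m ∩ Metric.closedBall (lam k) (C / n),
      ∀ y ∈ levelSet σ m ∩ Metric.closedBall (lam l) (C / n),
      minSeparation lam / 2 ≤ edist x y := by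
    intro k l hkl x hx y hy
    have h1 := hsepd k l hkl
    have hle := minSeparation_le lam hkl
    -- Moving both centres costs at most `2C/n`, which is at most half their distance.
    have h2 : dist (lam k) (lam l) / 2 ≤ dist x y := by
      have ha := Metric.mem_closedBall.1 hx.2
      have hb := Metric.mem_closedBall.1 hy.2
      have hc := dist_triangle4 (lam k) x y (lam l)
      rw [dist_comm (lam k) x] at hc
      linarith
    calc minSeparation lam / 2 ≤ edist (lam k) (lam l) / 2 := by gcongr
      _ = ENNReal.ofReal (dist (lam k) (lam l) / 2) := by
          rw [edist_dist, ENNReal.ofReal_div_of_pos two_pos, ENNReal.ofReal_ofNat]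
      _ ≤ edist x y := by rw [edist_dist]; exact ENNReal.ofReal_le_ofReal h2
  refine ⟨fun k => levelSet σ m ∩ Metric.closedBall (lam k) (C / n), ?_, ?_, ?_, hsepG, hball,
    ?_, ?_⟩
  · rw [← Set.inter_iUnion]
    refine (Set.inter_eq_left.2 fun x hx => ?_).symm
    by_contra hcon
    simp only [Set.mem_iUnion, Metric.mem_closedBall, not_exists, not_le] at hcon
    have h1 := hsum Finset.univ x fun k _ => (hcon k).le
    have h2 : ‖σ x‖ ≤ m / 16 + m / 16 := by
      rw [hσx]
      exact (norm_add_le _ _).trans (add_le_add h1 (hd x))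
    have h3 : m / 2 ≤ ‖σ x‖ := hx
    linarith
  · intro k l hkl
    refine Set.disjoint_left.2 fun x hx hy => ?_
    have h1 := hsepd k l hkl
    have h2 := dist_triangle_left (lam k) (lam l) x
    have ha := Metric.mem_closedBall.1 hx.2
    have hb := Metric.mem_closedBall.1 hy.2
    linarith
  · intro k
    rw [h2C]
    exact (Metric.diam_mono Set.inter_subset_right Metric.isBounded_closedBall).trans
      (Metric.diam_closedBall hCn0.le)
  · intro k
    have hcpt : IsCompact (levelSet σ m ∩ Metric.closedBall (lam k) (C / n)) :=
      ((isClosed_le continuous_const hcont).inter Metric.isClosed_closedBall).isCompact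
    exact hcpt.exists_isMaxOn ⟨lam k, hball k (Metric.mem_closedBall_self (by positivity))⟩
      hcont.continuousOn
  · intro k x hx _
    have := Metric.mem_closedBall.1 hx.2
    linarith

/-! ### Trigonometric polynomials on a grid. -/

theorem norm_fourier_apply (ℓ : ℤ) (x : Torus) : ‖fourier ℓ x‖ = 1 := by
  rw [fourier_apply]; exact Circle.norm_coe _

theorem norm_fourier_sub_le (ℓ : ℤ) (x y : Torus) :
    ‖fourier ℓ x - fourier ℓ y‖ ≤ |(ℓ : ℝ)| * dist x y := by
  have h1 : fourier (-ℓ) y * (fourier ℓ x - fourier ℓ y) = fourier ℓ (x - y) - 1 := by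
    rw [mul_sub, fourier_mul_fourier_neg, fourier_mul_fourier_neg, sub_self, fourier_eval_zero]
  have h2 : ‖fourier ℓ x - fourier ℓ y‖ = ‖fourier ℓ (x - y) - 1‖ := by
    rw [← h1, norm_mul, norm_fourier_apply, one_mul]
  obtain ⟨r, hr, hr1, -⟩ := exists_coe_eq_abs_eq_norm (x - y)
  rw [h2, dist_eq_norm, ← hr1, ← hr, fourier_coe_torus, ← abs_mul, ← Real.norm_eq_abs, mul_comm]
  exact Real.norm_exp_I_mul_ofReal_sub_one_le

section TrigPolynomial

variable {s : Finset ℤ} {c : ℤ → ℂ}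

theorem fourierCoeff_sum_fourier (s : Finset ℤ) (c : ℤ → ℂ) {m : ℤ} (hm : m ∈ s) :
    fourierCoeff (fun x : Torus => ∑ ℓ ∈ s, c ℓ * fourier ℓ x) m = c m := by
  have h : (fun x : Torus => ∑ ℓ ∈ s, c ℓ * fourier ℓ x)
      = ∑ ℓ ∈ s, fun x : Torus => c ℓ * fourier ℓ x := by
    funext x; simp only [Finset.sum_apply]
  rw [h, fourierCoeff.sum, Finset.sum_apply, Finset.sum_eq_single m]
  · rw [fourierCoeff.const_mul, fourierCoeff_fourier]; simp
  · intro ℓ _ hℓ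
    rw [fourierCoeff.const_mul, fourierCoeff_fourier, Pi.single_eq_of_ne hℓ.symm, mul_zero]
  · exact fun h => absurd hm h
  · intro ℓ _
    exact (by fun_prop : Continuous fun x : Torus => c ℓ * fourier ℓ x)
      |>.integrable_of_hasCompactSupport (HasCompactSupport.of_compactSpace _)

/-- A coefficient is a mean of the polynomial against a unimodular character. This yields a crude
substitute for Bernstein's inequality. -/
theorem norm_coeff_le_of_norm_le {B : ℝ} (hB : ∀ x : Torus, ‖∑ ℓ ∈ s, c ℓ * fourier ℓ x‖ ≤ B)
    {m : ℤ} (hm : m ∈ s) : ‖c m‖ ≤ B := by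
  rw [← fourierCoeff_sum_fourier s c hm, fourierCoeff]
  refine (norm_integral_le_of_norm_le_const (C := B) (ae_of_all _ fun x => ?_)).trans (by simp)
  rw [norm_smul, norm_fourier_apply, one_mul]
  exact hB x

theorem exists_dist_grid_le {N : ℕ} (hN : 0 < N) (x : Torus) :
    ∃ j ∈ Finset.range N, dist x ((2 * Real.pi / N * j : ℝ) : Torus) ≤ 2 * Real.pi / N := by
  have hN0 : (0 : ℝ) < N := by exact_mod_cast hN
  have hpi := Real.two_pi_pos
  obtain ⟨r, hr, rfl⟩ : ∃ r ∈ Set.Ico (0 : ℝ) (0 + 2 * Real.pi), (r : Torus) = x := by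
    have h := AddCircle.coe_image_Ico_eq (2 * Real.pi) 0
    exact h.ge (Set.mem_univ x)
  set q := 2 * Real.pi / N
  have hq : 0 < q := by positivity
  have hr0 : 0 ≤ r / q := div_nonneg hr.1 hq.le
  refine ⟨⌊r / q⌋₊, ?_, ?_⟩
  · rw [Finset.mem_range, Nat.floor_lt hr0, div_lt_iff₀ hq]
    have : (N : ℝ) * q = 2 * Real.pi := by simp only [q]; field_simp
    rw [this]; linarith [hr.2]
  · rw [dist_eq_norm, ← AddCircle.coe_sub]
    refine QuotientAddGroup.norm_mk_le_norm.trans ?_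
    have h1 := Nat.floor_le hr0
    have h2 := Nat.lt_floor_add_one (r / q)
    rw [le_div_iff₀ hq] at h1
    rw [div_lt_iff₀ hq] at h2
    rw [Real.norm_eq_abs, abs_le]
    constructor <;> nlinarith

/-- A trigonometric polynomial of degree less than `n` is at most twice its maximum on a grid of
`26 n²` equidistant points. -/
theorem norm_sum_fourier_le_of_grid {n : ℕ} (hn : 1 ≤ n) {t : ℝ}
    (ht : ∀ j ∈ Finset.range (26 * n ^ 2), ‖∑ ℓ ∈ Finset.Ioo (-(n : ℤ)) n,
      c ℓ * fourier ℓ ((2 * Real.pi / (26 * n ^ 2 : ℕ) * j : ℝ) : Torus)‖ ≤ t) (x : Torus) :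
    ‖∑ ℓ ∈ Finset.Ioo (-(n : ℤ)) n, c ℓ * fourier ℓ x‖ ≤ 2 * t := by
  have hn0 : (0 : ℝ) < n := by exact_mod_cast hn
  have hcont : Continuous fun x : Torus =>
      ‖∑ ℓ ∈ Finset.Ioo (-(n : ℤ)) n, c ℓ * fourier ℓ x‖ := by fun_prop
  obtain ⟨x₀, -, hx₀⟩ := isCompact_univ.exists_isMaxOn Set.univ_nonempty hcont.continuousOn
  have hmax : ∀ x, ‖∑ ℓ ∈ Finset.Ioo (-(n : ℤ)) n, c ℓ * fourier ℓ x‖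
      ≤ ‖∑ ℓ ∈ Finset.Ioo (-(n : ℤ)) n, c ℓ * fourier ℓ x₀‖ := fun x => hx₀ (Set.mem_univ x)
  refine (hmax x).trans ?_
  set B := ‖∑ ℓ ∈ Finset.Ioo (-(n : ℤ)) n, c ℓ * fourier ℓ x₀‖
  have hB0 : 0 ≤ B := norm_nonneg _
  obtain ⟨j, hj, hdist⟩ := exists_dist_grid_le (N := 26 * n ^ 2) (by positivity) x₀
  have hy := ht j hj
  set y : Torus := ((2 * Real.pi / (26 * n ^ 2 : ℕ) * j : ℝ) : Torus)
  -- Fewer than `2n` terms, coefficients at most `B`, frequencies below `n`, spacing `2π/(26n²)`: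
  -- the change is at most `2πB/13 < B/2` when `B > 0`, whence the 26. Then `B ≤ t + B/2`.
  have hdiff : ‖∑ ℓ ∈ Finset.Ioo (-(n : ℤ)) n, c ℓ * fourier ℓ x₀
      - ∑ ℓ ∈ Finset.Ioo (-(n : ℤ)) n, c ℓ * fourier ℓ y‖ ≤ B / 2 := by
    rw [← Finset.sum_sub_distrib]
    calc _ ≤ ∑ ℓ ∈ Finset.Ioo (-(n : ℤ)) n, B * (n * (2 * Real.pi / (26 * n ^ 2 : ℕ))) := by
          refine (norm_sum_le _ _).trans (Finset.sum_le_sum fun ℓ hℓ => ?_)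
          rw [← mul_sub, norm_mul]
          have h1 : |(ℓ : ℝ)| ≤ n := by
            have := abs_lt.2 (Finset.mem_Ioo.1 hℓ)
            exact_mod_cast this.le
          have h2 : ‖c ℓ‖ ≤ B := norm_coeff_le_of_norm_le hmax hℓ
          have h3 := norm_fourier_sub_le ℓ x₀ y
          gcongr
          exact h3.trans (by gcongr)
      _ = ((2 * n - 1 : ℕ) : ℝ) * (B * (n * (2 * Real.pi / (26 * n ^ 2 : ℕ)))) := by
          rw [Finset.sum_const, Int.card_Ioo, nsmul_eq_mul]
          congr 3
          omega
      _ ≤ (2 * n) * (B * (n * (2 * Real.pi / (26 * n ^ 2 : ℕ)))) := by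
          have hc : ((2 * n - 1 : ℕ) : ℝ) ≤ 2 * n := by
            exact_mod_cast Nat.sub_le (2 * n) 1
          have hpi := Real.pi_pos
          gcongr
      _ = B * (2 * Real.pi / 13) := by push_cast; field_simp; ring
      _ ≤ B * (1 / 2) := mul_le_mul_of_nonneg_left (by linarith [Real.pi_lt_d2]) hB0
      _ = B / 2 := by ring
  have := norm_le_norm_add_norm_sub' (∑ ℓ ∈ Finset.Ioo (-(n : ℤ)) n, c ℓ * fourier ℓ x₀)
    (∑ ℓ ∈ Finset.Ioo (-(n : ℤ)) n, c ℓ * fourier ℓ y)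
  linarith

end TrigPolynomial

theorem powerSpectrum_eq_sum (H : ℝ → ℝ) (n : ℕ) (d : ℤ → ℂ) (x : Torus) :
    powerSpectrum H n d x = ∑ ℓ ∈ Finset.Ioo (-(n : ℤ)) (n : ℤ),
      ((hbar H n : ℂ) * H (|(ℓ : ℝ)| / n) * d ℓ) * fourier ℓ x := by
  rw [powerSpectrum, Finset.mul_sum]
  exact Finset.sum_congr rfl fun ℓ _ => by ring

theorem norm_powerSpectrum_le_of_grid (H : ℝ → ℝ) {n : ℕ} (hn : 1 ≤ n) (d : ℤ → ℂ) {t : ℝ}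
    (ht : ∀ j ∈ Finset.range (26 * n ^ 2),
      ‖powerSpectrum H n d ((2 * Real.pi / (26 * n ^ 2 : ℕ) * j : ℝ) : Torus)‖ ≤ t) (x : Torus) :
    ‖powerSpectrum H n d x‖ ≤ 2 * t := by
  simp only [powerSpectrum_eq_sum] at ht ⊢
  exact norm_sum_fourier_le_of_grid hn ht x

/-! ### Concentration of the noise. -/

section Noise

variable {Ω : Type*} [MeasurableSpace Ω] {P : Measure Ω}

theorem ProbabilityTheory.HasSubgaussianMGF.mono {X : Ω → ℝ} {c c' : ℝ≥0}
    (h : HasSubgaussianMGF X c P) (hc : c ≤ c') : HasSubgaussianMGF X c' P where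
  integrable_exp_mul := h.integrable_exp_mul
  mgf_le t := (h.mgf_le t).trans (by gcongr)

theorem IsComplexSubGaussian.mono {X : Ω → ℂ} {V V' : ℝ≥0} (h : IsComplexSubGaussian X V P)
    (hV : V ≤ V') : IsComplexSubGaussian X V' P :=
  ⟨h.1.mono (by gcongr), h.2.mono (by gcongr)⟩

/-- Real and imaginary parts may be dependent; the factor 2 is the price, through `(a + b)² ≤ 2(a² +
b²)`. -/
theorem IsComplexSubGaussian.hasSubgaussianMGF_re_mul {X : Ω → ℂ} {V : ℝ≥0}
    (h : IsComplexSubGaussian X V P) (z : ℂ) :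
    HasSubgaussianMGF (fun ω => (z * X ω).re) (2 * ‖z‖₊ ^ 2 * V ^ 2) P := by
  have h1 := (h.1.const_mul z.re).add (h.2.const_mul (-z.im))
  have e : (fun ω => (z * X ω).re) = fun ω => z.re * (X ω).re + -z.im * (X ω).im := by
    funext ω; rw [Complex.mul_re]; ring
  rw [e]
  refine h1.mono (add_sq_le.trans ?_)
  rw [NNReal.sq_sqrt, NNReal.sq_sqrt, ← NNReal.coe_le_coe]
  change 2 * (z.re ^ 2 * (V : ℝ) ^ 2 + (-z.im) ^ 2 * (V : ℝ) ^ 2) ≤ 2 * ‖z‖ ^ 2 * (V : ℝ) ^ 2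
  rw [Complex.sq_norm, Complex.normSq_apply]
  linarith

/-- Tail bound for the noise part of the reconstruction at a single point. -/
theorem IsLowPassFilter.measure_re_powerSpectrum_ge_le {H : ℝ → ℝ} (hH : IsLowPassFilter H)
    {n : ℕ} (hn : 1 ≤ n) {V : ℝ≥0} {ε : ℤ → Ω → ℂ}
    (hind : iIndepFun (fun ℓ : {ℓ : ℤ // |ℓ| < n} => ε ℓ) P)
    (hsub : ∀ ℓ : ℤ, |ℓ| < n → IsComplexSubGaussian (ε ℓ) V P)
    (x : Torus) {θ : ℂ} (hθ : ‖θ‖ = 1) {s : ℝ} (hs : 0 ≤ s) :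
    P.real {ω | s ≤ (θ * powerSpectrum H n (fun ℓ => ε ℓ ω) x).re}
      ≤ Real.exp (-(s ^ 2 * n / (4 * V ^ 2))) := by
  have hn0 : (0 : ℝ) < n := by exact_mod_cast hn
  set z : ℤ → ℂ := fun ℓ => θ * (hbar H n * H (|(ℓ : ℝ)| / n)) * fourier ℓ x with hz
  have hzn : ∀ ℓ, ‖z ℓ‖ = hbar H n * H (|(ℓ : ℝ)| / n) := by
    intro ℓ
    rw [hz]
    simp only [norm_mul, hθ, norm_fourier_apply, Complex.norm_real, one_mul, mul_one,
      Real.norm_of_nonneg (hH.hbar_pos hn).le, Real.norm_of_nonneg (hH.mem_Icc _).1]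
  have hmem : ∀ ℓ ∈ Finset.Ioo (-(n : ℤ)) (n : ℤ), |ℓ| < n := fun ℓ hℓ =>
    abs_lt.2 (Finset.mem_Ioo.1 hℓ)
  have hsum := HasSubgaussianMGF.sum_of_iIndepFun
    (hind.comp (fun ℓ w => (z ℓ * w).re) fun ℓ => by fun_prop)
    (s := (Finset.Ioo (-(n : ℤ)) (n : ℤ)).subtype fun ℓ => |ℓ| < (n : ℤ))
    fun i _ => (hsub i i.2).hasSubgaussianMGF_re_mul (z i)
  have e1 : (fun ω => ∑ i ∈ (Finset.Ioo (-(n : ℤ)) (n : ℤ)).subtype fun ℓ => |ℓ| < (n : ℤ),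
      ((fun w => (z i * w).re) ∘ ε i) ω)
      = fun ω => (θ * powerSpectrum H n (fun ℓ => ε ℓ ω) x).re := by
    funext ω
    rw [Finset.sum_subtype_of_mem (fun ℓ => ((fun w => (z ℓ * w).re) ∘ ε ℓ) ω) hmem,
      powerSpectrum_eq_sum, Finset.mul_sum, Complex.re_sum]
    refine Finset.sum_congr rfl fun ℓ _ => ?_
    simp only [Function.comp, hz]
    congr 1; ring
  rw [e1, Finset.sum_subtype_of_mem (fun ℓ => 2 * ‖z ℓ‖₊ ^ 2 * V ^ 2) hmem] at hsum
  -- As `H² ≤ H` and `ħ_n ∑ H = 1`, the proxies add up to at most `2V²ħ_n ≤ 2V²/n`.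
  have hc : ∑ ℓ ∈ Finset.Ioo (-(n : ℤ)) (n : ℤ), 2 * ‖z ℓ‖₊ ^ 2 * V ^ 2
      ≤ 2 * V ^ 2 / (n : ℝ≥0) := by
    rw [← NNReal.coe_le_coe]
    push_cast
    have hb := hH.hbar_pos hn
    calc ∑ ℓ ∈ Finset.Ioo (-(n : ℤ)) (n : ℤ), 2 * ‖z ℓ‖ ^ 2 * (V : ℝ) ^ 2
        ≤ ∑ ℓ ∈ Finset.Ioo (-(n : ℤ)) (n : ℤ),
          2 * (V : ℝ) ^ 2 * hbar H n * (hbar H n * H (|(ℓ : ℝ)| / n)) := by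
          refine Finset.sum_le_sum fun ℓ _ => ?_
          have h0 := hH.mem_Icc (|(ℓ : ℝ)| / n)
          rw [hzn]
          have : H (|(ℓ : ℝ)| / n) ^ 2 ≤ H (|(ℓ : ℝ)| / n) := by nlinarith [h0.1, h0.2]
          calc _ = 2 * (V : ℝ) ^ 2 * hbar H n ^ 2 * H (|(ℓ : ℝ)| / n) ^ 2 := by ring
            _ ≤ 2 * (V : ℝ) ^ 2 * hbar H n ^ 2 * H (|(ℓ : ℝ)| / n) := by gcongr
            _ = _ := by ring
      _ = 2 * (V : ℝ) ^ 2 * hbar H n := by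
          rw [← Finset.mul_sum, ← Finset.mul_sum, hH.hbar_mul_sum hn, mul_one]
      _ ≤ 2 * (V : ℝ) ^ 2 / n := by
          rw [le_div_iff₀ hn0, mul_assoc]
          have := hH.hbar_mul_le_one hn
          exact mul_le_of_le_one_right (by positivity) this
  refine ((hsum.mono hc).measure_ge_le hs).trans (le_of_eq ?_)
  congr 1
  push_cast
  rw [neg_div]
  congr 1
  rw [mul_div_assoc', div_div_eq_mul_div]
  ring_nf

/-- Uniform bound for the noise part of the reconstruction. -/
theorem IsLowPassFilter.exists_norm_powerSpectrum_le {H : ℝ → ℝ} (hH : IsLowPassFilter H)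
    [IsProbabilityMeasure P] {n : ℕ} (hn : 1 ≤ n) {V : ℝ≥0} {ε : ℤ → Ω → ℂ}
    (hind : iIndepFun (fun ℓ : {ℓ : ℤ // |ℓ| < n} => ε ℓ) P)
    (hsub : ∀ ℓ : ℤ, |ℓ| < n → IsComplexSubGaussian (ε ℓ) V P) {s : ℝ} (hs : 0 ≤ s) :
    ∃ E : Set Ω, MeasurableSet E ∧
      1 - 104 * n ^ 2 * Real.exp (-(s ^ 2 * n / (4 * V ^ 2))) ≤ P.real E ∧
      ∀ ω ∈ E, ∀ x, ‖powerSpectrum H n (fun ℓ => ε ℓ ω) x‖ ≤ 4 * s := by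
  set g : ℕ → Torus := fun j => ((2 * Real.pi / (26 * n ^ 2 : ℕ) * j : ℝ) : Torus) with hg
  -- The four rotations `i^q` bound `±Re` and `±Im` by one-sided tails, giving `4 · 26n² = 104n²`
  -- events.
  set bad : ℕ × ℕ → Set Ω := fun p =>
    {ω | s ≤ (Complex.I ^ p.2 * powerSpectrum H n (fun ℓ => ε ℓ ω) (g p.1)).re} with hbad
  set T := Finset.range (26 * n ^ 2) ×ˢ Finset.range 4 with hT
  -- Passing to a measurable hull keeps the measure and needs no measurability of the bad events.
  refine ⟨(toMeasurable P (⋃ p ∈ T, bad p))ᶜ, (measurableSet_toMeasurable _ _).compl, ?_, ?_⟩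
  · rw [probReal_compl_eq_one_sub (measurableSet_toMeasurable _ _), Measure.real,
      measure_toMeasurable]
    refine sub_le_sub_left ?_ _
    refine (measureReal_biUnion_finset_le T bad).trans ?_
    refine (Finset.sum_le_sum fun p _ => hH.measure_re_powerSpectrum_ge_le hn hind hsub (g p.1)
      (θ := Complex.I ^ p.2) (by simp) hs).trans (le_of_eq ?_)
    rw [Finset.sum_const, hT, Finset.card_product, Finset.card_range, Finset.card_range,
      nsmul_eq_mul]
    push_cast; ring
  · intro ω hω x
    have hω' : ∀ p ∈ T, ω ∉ bad p := fun p hp h =>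
      hω (subset_toMeasurable _ _ (Set.mem_biUnion hp h))
    -- `|Re| + |Im| ≤ 2s` on the grid, and a factor 2 off it.
    have h4 : 4 * s = 2 * (2 * s) := by ring
    rw [h4]
    refine norm_powerSpectrum_le_of_grid H hn _ (fun j hj => ?_) x
    have hq : ∀ q < 4, (Complex.I ^ q * powerSpectrum H n (fun ℓ => ε ℓ ω) (g j)).re < s :=
      fun q hq => not_le.1 (hω' (j, q) (Finset.mk_mem_product hj (Finset.mem_range.2 hq)))
    have h0 := hq 0 (by norm_num)
    have h1 := hq 1 (by norm_num)
    have h2 := hq 2 (by norm_num)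
    have h3 := hq 3 (by norm_num)
    rw [Complex.I_sq] at h2
    rw [Complex.I_pow_three] at h3
    simp only [pow_zero, pow_one, one_mul, neg_mul, Complex.neg_re, Complex.I_mul_re, neg_neg]
      at h0 h1 h2 h3
    refine (Complex.norm_le_abs_re_add_abs_im _).trans ?_
    have a1 := abs_le.2 ⟨by linarith, h0.le⟩
    have a2 := abs_le.2 ⟨by linarith, h3.le⟩
    linarith

end Noise

/-! ### Choice of the constants and conclusion. -/

/-- The failure probability of the union bound over the grid is below `δ`. -/
theorem union_bound_lt {n : ℕ} (hn : 1 ≤ n) {δ : ℝ} (hδ : 0 < δ) (hδ1 : δ < 1) :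
    104 * (n : ℝ) ^ 2 * Real.exp (-(4 * Real.log (4 * n / δ))) < δ := by
  have hn1 : (1 : ℝ) ≤ n := by exact_mod_cast hn
  have hx : 0 < 4 * (n : ℝ) / δ := by positivity
  have e : Real.exp (-(4 * Real.log (4 * n / δ))) = (δ / (4 * n)) ^ 4 := by
    rw [Real.exp_neg, mul_comm, Real.exp_mul, Real.exp_log hx]
    norm_cast
    rw [← inv_pow, inv_div]
  rw [e]
  have h : 104 * (n : ℝ) ^ 2 * (δ / (4 * n)) ^ 4 = δ * (104 / 256 * (δ ^ 3 / n ^ 2)) := by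
    field_simp; norm_num
  rw [h]
  refine mul_lt_of_lt_one_right hδ ?_
  have h1 : δ ^ 3 ≤ 1 := pow_le_one₀ hδ.le hδ1.le
  have h2 : δ ^ 3 / (n : ℝ) ^ 2 ≤ 1 := div_le_one_of_le₀ (h1.trans (one_le_pow₀ hn1)) (by positivity)
  linarith

theorem theorem2p3p1 (H : ℝ → ℝ) (hH : IsLowPassFilter H) :
    -- the constants depend on the filter only
    ∃ C₁ C₂ C₃ : ℝ, 1 ≤ C₁ ∧ 0 < C₂ ∧ 0 < C₃ ∧
      ∀ (S : ℕ), 2 ≤ S →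
      ∀ (K : ℕ), 1 ≤ K →
      ∀ (A : Fin K → ℂ) (lam : Fin K → Torus), (∀ k, A k ≠ 0) →
      ∀ (V : ℝ≥0) (δ : ℝ), 0 < δ → δ < 1 →
      ∀ (n : ℕ),
        -- `n` is sufficiently large
        C₁ ≤ n →
        ENNReal.ofReal (4 * clusterConst H S A) / minSeparation lam ≤ n →
        C₂ * V * √(Real.log (C₃ * n / δ) / n) ≤ minAmplitude A / 16 →
      ∀ {Ω : Type*} [MeasurableSpace Ω] (P : Measure Ω) [IsProbabilityMeasure P]
        (ε : ℤ → Ω → ℂ),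
        -- the noise `ε_ℓ`, `|ℓ| < n`, is i.i.d. and sub-Gaussian with parameter `V`
        iIndepFun (fun ℓ : {ℓ : ℤ // |ℓ| < n} => ε ℓ) P →
        (∀ ℓ ℓ' : ℤ, |ℓ| < n → |ℓ'| < n → IdentDistrib (ε ℓ) (ε ℓ') P P) →
        (∀ ℓ : ℤ, |ℓ| < n → IsComplexSubGaussian (ε ℓ) V P) →
        ∃ E : Set Ω, MeasurableSet E ∧ 1 - δ < P.real E ∧ ∀ ω ∈ E,
          ∀ σ : Torus → ℂ, σ = powerSpectrum H n (fun ℓ => fourierData A lam ℓ + ε ℓ ω) →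
          ∃ G : Fin K → Set Torus,
            -- disjoint union
            levelSet σ (minAmplitude A) = ⋃ k, G k ∧
            Pairwise (fun k l => Disjoint (G k) (G l)) ∧
            -- diameter
            (∀ k, Metric.diam (G k) ≤ 2 * clusterConst H S A / n) ∧
            -- separation
            (∀ k l, k ≠ l → ∀ x ∈ G k, ∀ y ∈ G l, minSeparation lam / 2 ≤ edist x y) ∧
            -- interval inclusion
            (∀ k, Metric.closedBall (lam k) (1 / (4 * n)) ⊆ G k) ∧
            -- the maximum of `|σ_n|` on each cluster is attained, and every maximizer is close
            -- to the corresponding point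
            (∀ k, ∃ x ∈ G k, IsMaxOn (fun y => ‖σ y‖) (G k) x) ∧
            (∀ k, ∀ x ∈ G k, IsMaxOn (fun y => ‖σ y‖) (G k) x →
              dist x (lam k) ≤ 2 * clusterConst H S A / n) := by

  -- With `C₂ = 16` the hypothesis reads `V R ≤ 𝔪/256`, so `s = 4WR` gives noise `4s = 𝔪/16` and
  -- tail exponent `4Λ`. With `C₃ = 4`, `Λ > 0` and `exp(-4Λ)` beats `104n²`.
  refine ⟨1, 16, 4, le_rfl, by norm_num, by norm_num, ?_⟩
  intro S hS K hK A lam hA V δ hδ hδ1 n hn1 hsep hV Ω _ P _ ε hind _ hsub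
  have hn : 1 ≤ n := by exact_mod_cast hn1
  have hn0 : (0 : ℝ) < n := by exact_mod_cast hn
  have hm := minAmplitude_pos hK hA
  have hlog : 0 < Real.log (4 * n / δ) := by
    apply Real.log_pos
    rw [one_lt_div hδ]
    linarith
  set Λ := Real.log (4 * n / δ)
  set R := √(Λ / n)
  have hR : 0 < R := Real.sqrt_pos.2 (by positivity)
  have hR2 : R ^ 2 = Λ / n := Real.sq_sqrt (by positivity)
  -- enlarging the variance proxy makes the hypothesis on the noise level an equality
  set W : ℝ≥0 := ⟨minAmplitude A / 256 / R, by positivity⟩ with hW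
  have hWR : (W : ℝ) * R = minAmplitude A / 256 := div_mul_cancel₀ _ hR.ne'
  -- `V = 0` is allowed, and division by zero would then make the tail bound the trivial 1; `W` is
  -- positive.
  have hW0 : (0 : ℝ) < W := by change 0 < minAmplitude A / 256 / R; positivity
  have hVW : V ≤ W := by
    rw [← NNReal.coe_le_coe]
    change (V : ℝ) ≤ minAmplitude A / 256 / R
    rw [le_div_iff₀ hR]
    linarith
  obtain ⟨E, hE, hPE, hnoise⟩ := hH.exists_norm_powerSpectrum_le hn hind
    (fun ℓ hℓ => (hsub ℓ hℓ).mono hVW) (s := 4 * (W * R)) (by positivity)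
  have hexp : (4 * ((W : ℝ) * R)) ^ 2 * n / (4 * (W : ℝ) ^ 2) = 4 * Λ := by
    rw [mul_pow, mul_pow, hR2]; field_simp
  rw [hexp] at hPE
  refine ⟨E, hE, ?_, fun ω hω σ hσ => ?_⟩
  · have := union_bound_lt hn hδ hδ1
    linarith
  · refine clusters_of_noise_le hH hS hK lam hA hn hsep (d := fun ℓ => ε ℓ ω) (fun x => ?_) hσ
    refine (hnoise ω hω x).trans (le_of_eq ?_)
    rw [hWR]; ring
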